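/- All rings are commutative with identity. A ring $R$ satisfies Prüfer condition (1) if every finitely generated ideal of $R$ is projective (semihereditary ring); (2) if every ideal of $R$ is flat (weak global dimension $\le 1$); (3) if $\mathfrak a\cap(\mathfrak b+\mathfrak c)=(\mathfrak a\cap\mathfrak b)+(\mathfrak a\cap\mathfrak c)$ for all ideals $\mathfrak a,\mathfrak b,\mathfrak c$ of $R$ (arithmetical ring); (4) if $c(f)c(g)=c(fg)$ for all $f,g\in R[X]$, where $c(f)$ is the ideal of $R$ generated by the coefficients of $f$ (Gaussian ring); (5) if every finitely generated ideal of $R$ that contains a regular element (a non-zero-divisor) is invertible in the total ring of fractions $\operatorname{Tot}(R)$ (Prüfer ring). A ring is absolutely flat if all modules over it are flat. If $R$ is a subring of $T$, then $T$ is called an overring of $R$ if there is an injective ring homomorphism $T\to\operatorname{Tot}(R)$ that restricts to the canonical map on $R$. Proposition. Let $\pi\colon B\to T$ be a surjective ring homomorphism whose kernel contains a regular element of $B$, let $R$ be a subring of $T$ such that $\operatorname{Tot}(R)$ is absolutely flat, and set $A:=\pi^{-1}(R)$. Then, for each $n=1,\dots,5$, the ring $A$ satisfies Prüfer condition $(n)$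 if and only if both $B$ and $R$ satisfy Prüfer condition $(n)$ and $T$ is an overring of $R$. -/

import Mathlib

universe u v

open scoped nonZeroDivisors

/-- A commutative ring is semihereditary if every finitely generated ideal is projective. -/
def IsSemihereditaryRing (R : Type u) [CommRing R] : Prop :=
  ∀ I : Ideal R, I.FG → Module.Projective R I

/-- A commutative ring has weak global dimension at most one if every ideal is flat. -/
def HasWeakGlobalDimLEOne (R : Type u) [CommRing R] : Prop :=
  ∀ I : Ideal R, Module.Flat R I

/-- A commutative ring is arithmetical if its lattice of ideals is distributive. -/
def IsArithmeticalRing (R : Type u) [CommRing R] : Prop :=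
  ∀ I J K : Ideal R, I ⊓ (J + K) = (I ⊓ J) + (I ⊓ K)

/-- A polynomial `f` is Gaussian if `c(f) c(g) = c(f g)` for every polynomial `g`, where `c` denotes
the content ideal. -/
def IsGaussianPolynomial {R : Type u} [CommRing R] (f : Polynomial R) : Prop :=
  ∀ g : Polynomial R, f.contentIdeal * g.contentIdeal = (f * g).contentIdeal

/-- A commutative ring is Gaussian if every polynomial over it is Gaussian. -/
def IsGaussianRing (R : Type u) [CommRing R] : Prop :=
  ∀ f : Polynomial R, IsGaussianPolynomial f

/-- An ideal is regular if it contains a regular element (a non-zero-divisor). -/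
def IsRegularIdeal {R : Type u} [CommRing R] (I : Ideal R) : Prop :=
  ∃ r ∈ I, r ∈ R⁰

/-- A commutative ring is a Prüfer ring if every finitely generated regular ideal is invertible,
that is, a unit among the fractional ideals in the total ring of fractions. -/
def IsPruferRing (R : Type u) [CommRing R] : Prop :=
  ∀ I : Ideal R, I.FG → IsRegularIdeal I → IsUnit (I : FractionalIdeal R⁰ (FractionRing R))

/-- Prüfer condition `(n)`, for `1 ≤ n ≤ 5`. -/
def HasPruferCondition (n : ℕ) (R : Type u) [CommRing R] : Prop :=
  match n with
  | 1 => IsSemihereditaryRing R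
  | 2 => HasWeakGlobalDimLEOne R
  | 3 => IsArithmeticalRing R
  | 4 => IsGaussianRing R
  | 5 => IsPruferRing R
  | _ => False

/-- A commutative ring is absolutely flat if every module over it is flat. -/
def IsAbsolutelyFlat (R : Type u) [CommRing R] : Prop :=
  ∀ (M : Type u) [AddCommGroup M] [Module R M], Module.Flat R M

/-- `T` is an overring of `R`: up to an isomorphism over `R`, it is a subring of the total ring of
fractions of `R` containing `R`. -/
def IsOverring (R : Type u) (T : Type v) [CommRing R] [CommRing T] [Algebra R T] : Prop :=
  ∃ f : T →ₐ[R] FractionRing R, Function.Injective f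

/-! Each condition is reduced to statements about elements. Condition (5) says that 1 ∈ (s : a) + (a
: s) for every `a` and every regular `s` (`isPruferRing_iff`); (3) says this for all pairs; (2) is
(3) plus reducedness; (1) is (5) plus idempotent supports. All five imply (5), and over `R`, whose
total ring of fractions is absolutely flat, (5) implies (1); so the five conditions on `R` coincide.

The rings A and `B` share the ideal ker π, which contains a regular element, so `B` consists of
fractions of A and each condition passes from A up to `B`. Descent needs A ⊆ `B` to be a Prüfer
extension, which by `isPruferExtension_comap_iff` means that R ⊆ T is one. That holds for every
overring of a Prüfer ring `R`; conversely, idempotent supports turn a Prüfer extension of `R` into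
an overring (`IsPruferExtension.isOverring`). Condition (4) descends locally, through the relation
`IsGaussDominated`, whose totality characterises local Gaussian rings. -/

/-- `u` is a sum of an element of `(b) : (a)` and an element of `(a) : (b)`. -/
def ComparableAt {R : Type u} [CommRing R] (u a b : R) : Prop :=
  ∃ p, b ∣ p * a ∧ a ∣ (u - p) * b

namespace ComparableAt

variable {R : Type u} [CommRing R] {u v a b : R}

theorem symm (h : ComparableAt u a b) : ComparableAt u b a := by
  obtain ⟨p, h₁, h₂⟩ := h
  exact ⟨u - p, h₂, by simpa using h₁⟩

theorem add (hu : ComparableAt u a b) (hv : ComparableAt v a b) : ComparableAt (u + v) a b := by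
  obtain ⟨p, h₁, h₂⟩ := hu
  obtain ⟨q, h₃, h₄⟩ := hv
  refine ⟨p + q, by simpa [add_mul] using dvd_add h₁ h₃, ?_⟩
  convert dvd_add h₂ h₄ using 1
  ring

end ComparableAt

/-! ### Comparability of elements and distributivity of ideals. -/

/-- Every element is comparable, up to a partition of unity, to every regular element. -/
def HasRegularComparability (R : Type u) [CommRing R] : Prop :=
  ∀ a s : R, s ∈ R⁰ → ComparableAt 1 a s

/-- Any two elements are comparable up to a partition of unity. -/
def HasComparability (R : Type u) [CommRing R] : Prop :=
  ∀ a b : R, ComparableAt 1 a b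

theorem HasComparability.hasRegularComparability {R : Type u} [CommRing R]
    (h : HasComparability R) : HasRegularComparability R := fun a s _ => h a s

theorem isArithmeticalRing_iff {R : Type u} [CommRing R] :
    IsArithmeticalRing R ↔ HasComparability R := by
  constructor
  · intro h a b
    -- Distributivity splits `a` into a multiple of `b` plus some s(a - b) ∈ (a); then b ∣ (1 - s)a
    -- and a ∣ sb.
    have h₁ : a ∈ Ideal.span {a} ⊓ (Ideal.span {b} + Ideal.span {a - b}) := by
      refine ⟨Ideal.mem_span_singleton_self a, ?_⟩
      rw [show a = b + (a - b) by ring]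
      refine Submodule.add_mem_sup (Ideal.mem_span_singleton_self b) ?_
      convert Ideal.mem_span_singleton_self (a - b) using 2
      ring_nf
    rw [h, Submodule.add_eq_sup, Submodule.mem_sup] at h₁
    obtain ⟨x, ⟨-, hx⟩, y, ⟨hy, hy'⟩, hxy⟩ := h₁
    obtain ⟨q, rfl⟩ := Ideal.mem_span_singleton.1 hx
    obtain ⟨r, hr⟩ := Ideal.mem_span_singleton.1 hy
    obtain ⟨s, hs⟩ := Ideal.mem_span_singleton.1 hy'
    exact ⟨1 - s, ⟨q - s, by linear_combination -hxy + hs⟩, ⟨s - r, by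
      linear_combination hs - hr⟩⟩
  · intro h I J K
    refine le_antisymm ?_ (sup_le (inf_le_inf_left _ le_sup_left) (inf_le_inf_left _ le_sup_right))
    rintro x ⟨hxI, hx⟩
    obtain ⟨j, hj, k, hk, rfl⟩ := Submodule.mem_sup.1 hx
    obtain ⟨t, ⟨c, hc⟩, ⟨d, hd⟩⟩ := h j k
    refine Submodule.mem_sup.2 ⟨(1 - t) * (j + k), ⟨I.mul_mem_left _ hxI, ?_⟩,
      t * (j + k), ⟨I.mul_mem_left _ hxI, ?_⟩, by ring⟩
    · rw [mul_add, hd]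
      exact J.add_mem (J.mul_mem_left _ hj) (J.mul_mem_right _ hj)
    · rw [mul_add, hc]
      exact K.add_mem (K.mul_mem_right _ hk) (K.mul_mem_left _ hk)

/-! ### Prüfer extensions and extensions by fractions. -/

/-- A Prüfer extension `A ⊆ B`: every `y : B` admits
a partition of unity `t + (1 - t)` in `A` with `t * y ∈ A` and `1 - t ∈ y A`. -/
def IsPruferExtension (A : Type u) (B : Type v) [CommRing A] [CommRing B] [Algebra A B] : Prop :=
  ∀ y : B, ∃ t d r : A,
    algebraMap A B t * y = algebraMap A B r ∧ algebraMap A B (1 - t) = y * algebraMap A B d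

/-- Every element of `B` is a fraction of elements of `A` whose denominator is regular in `B`. -/
def IsFractionExtension (A : Type u) (B : Type v) [CommRing A] [CommRing B] [Algebra A B] : Prop :=
  ∀ y : B, ∃ s c : A, algebraMap A B s ∈ B⁰ ∧ algebraMap A B s * y = algebraMap A B c

section Extension

variable {A : Type u} {B : Type v} [CommRing A] [CommRing B] [Algebra A B]

theorem mem_nonZeroDivisors_of_algebraMap (hinj : Function.Injective (algebraMap A B)) {s : A}
    (hs : algebraMap A B s ∈ B⁰) : s ∈ A⁰ := by
  rw [mem_nonZeroDivisors_iff_right] at hs ⊢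
  intro x hx
  refine (injective_iff_map_eq_zero _).1 hinj x (hs _ ?_)
  rw [← map_mul, hx, map_zero]

theorem IsPruferExtension.comparableAt_of_mul_eq (h : IsPruferExtension A B)
    (hinj : Function.Injective (algebraMap A B)) {w a b : A} {r : B}
    (hr : algebraMap A B (w * a) = algebraMap A B b * r) : ComparableAt w a b := by
  obtain ⟨t, d, c, h₁, h₂⟩ := h r
  refine ⟨t * w, ⟨c, hinj ?_⟩, ⟨w * d * w, hinj ?_⟩⟩
  · simp only [map_mul, map_sub, map_one] at *
    linear_combination algebraMap A B t * hr + algebraMap A B b * h₁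
  · simp only [map_mul, map_sub, map_one] at *
    linear_combination algebraMap A B w * algebraMap A B b * h₂
      - algebraMap A B w * algebraMap A B d * hr

/-- The coefficient t ∈ B need not lie in `A`. With c = τt ∈ A and 1 - τ ∈ tA, write 1 = c + (τ - c)
+ (1 - τ): each summand times `a` or `b` is divisible in `B` by the other element. -/
theorem IsPruferExtension.comparableAt (h : IsPruferExtension A B)
    (hinj : Function.Injective (algebraMap A B)) {a b : A}
    (hab : ComparableAt 1 (algebraMap A B a) (algebraMap A B b)) : ComparableAt 1 a b := by
  obtain ⟨t, ⟨r, hr⟩, ⟨r', hr'⟩⟩ := hab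
  obtain ⟨τ, d, c, h₁, h₂⟩ := h t
  have e₁ : ComparableAt c a b := h.comparableAt_of_mul_eq hinj (r := algebraMap A B τ * r) (by
    rw [map_mul, ← h₁]
    linear_combination algebraMap A B τ * hr)
  have e₂ : ComparableAt (τ - c) b a :=
    h.comparableAt_of_mul_eq hinj (r := algebraMap A B τ * r') (by
      rw [map_mul, map_sub, ← h₁]
      linear_combination algebraMap A B τ * hr')
  have e₃ : ComparableAt (1 - τ) a b :=
    h.comparableAt_of_mul_eq hinj (r := algebraMap A B d * r) (by
      rw [map_mul, h₂]
      linear_combination algebraMap A B d * hr)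
  convert (e₁.add e₂.symm).add e₃ using 1
  ring

theorem IsPruferExtension.hasRegularComparability (h : IsPruferExtension A B)
    (hinj : Function.Injective (algebraMap A B)) (hreg : ∀ s ∈ A⁰, algebraMap A B s ∈ B⁰)
    (hB : HasRegularComparability B) : HasRegularComparability A :=
  fun _ s hs => h.comparableAt hinj (hB _ _ (hreg s hs))

theorem IsPruferExtension.hasComparability (h : IsPruferExtension A B)
    (hinj : Function.Injective (algebraMap A B)) (hB : HasComparability B) : HasComparability A :=
  fun _ _ => h.comparableAt hinj (hB _ _)

/-- Since 1 - t ∈ eA is fixed by `e`, one gets e = te + (1 - t), and both terms lie in `A`. -/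
theorem IsPruferExtension.exists_isIdempotentElem (h : IsPruferExtension A B)
    (hinj : Function.Injective (algebraMap A B)) {e : B} (he : e * e = e) :
    ∃ e' : A, e' * e' = e' ∧ algebraMap A B e' = e := by
  obtain ⟨t, d, r, h₁, h₂⟩ := h e
  have h₃ : algebraMap A B (r + (1 - t)) = e := by
    rw [map_add, ← h₁]
    rw [map_sub, map_one] at *
    linear_combination (1 - e) * h₂ + algebraMap A B d * (-he)
  exact ⟨r + (1 - t), hinj (by rw [map_mul, h₃, he]), h₃⟩

theorem HasRegularComparability.isPruferExtension (h : HasRegularComparability A)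
    (hinj : Function.Injective (algebraMap A B)) (hB : IsFractionExtension A B) :
    IsPruferExtension A B := by
  intro y
  obtain ⟨s, c, hs, hc⟩ := hB y
  obtain ⟨t, ⟨r, hr⟩, ⟨d, hd⟩⟩ := h c s (mem_nonZeroDivisors_of_algebraMap hinj hs)
  replace hr := congrArg (algebraMap A B) hr
  replace hd := congrArg (algebraMap A B) hd
  simp only [map_mul] at hr hd
  refine ⟨t, d, r, (mul_cancel_left_mem_nonZeroDivisors hs).1 ?_,
    (mul_cancel_left_mem_nonZeroDivisors hs).1 ?_⟩
  · linear_combination algebraMap A B t * hc + hr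
  · linear_combination hd - algebraMap A B d * hc

/-- Clear both denominators, compare in `A`, and cancel. The conditional hypothesis serves regular
and unrestricted comparability alike. -/
theorem IsFractionExtension.comparableAt (hB : IsFractionExtension A B)
    (hinj : Function.Injective (algebraMap A B)) (a b : B)
    (h : ∀ a' b' : A, (b ∈ B⁰ → b' ∈ A⁰) → ComparableAt 1 a' b') : ComparableAt 1 a b := by
  obtain ⟨s, c, hs, hc⟩ := hB a
  obtain ⟨s', c', hs', hc'⟩ := hB b
  obtain ⟨t, ⟨r, hr⟩, ⟨d, hd⟩⟩ := h (s' * c) (s * c') fun hb =>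
    mem_nonZeroDivisors_of_algebraMap hinj (by
      rw [map_mul, ← hc']
      exact mul_mem hs (mul_mem hs' hb))
  replace hr := congrArg (algebraMap A B) hr
  replace hd := congrArg (algebraMap A B) hd
  simp only [map_mul, ← hc, ← hc', map_sub, map_one] at hr hd
  have hss := mul_mem hs hs'
  refine ⟨algebraMap A B t, ⟨algebraMap A B r, (mul_cancel_left_mem_nonZeroDivisors hss).1 ?_⟩,
    ⟨algebraMap A B d, (mul_cancel_left_mem_nonZeroDivisors hss).1 ?_⟩⟩
  · linear_combination hr
  · linear_combination hd

theorem IsFractionExtension.hasRegularComparability (hB : IsFractionExtension A B)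
    (hinj : Function.Injective (algebraMap A B)) (hA : HasRegularComparability A) :
    HasRegularComparability B :=
  fun _ _ hs => hB.comparableAt hinj _ _ fun a' s' h => hA a' s' (h hs)

theorem IsFractionExtension.hasComparability (hB : IsFractionExtension A B)
    (hinj : Function.Injective (algebraMap A B)) (hA : HasComparability A) :
    HasComparability B :=
  fun _ _ => hB.comparableAt hinj _ _ fun a' b' _ => hA a' b'

theorem isFractionExtension_of_isFractionRing [IsFractionRing A B] : IsFractionExtension A B := by
  intro y
  obtain ⟨⟨c, s⟩, h⟩ := IsLocalization.surj A⁰ y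
  exact ⟨s, c, (IsLocalization.map_units B s).mem_nonZeroDivisors, by rw [← h, mul_comm]⟩

end Extension

/-! ### Idempotent supports. -/

/-- Every element is supported on an idempotent, and regular there (p.p. ring). -/
def HasIdempotentSupports (R : Type u) [CommRing R] : Prop :=
  ∀ a : R, ∃ e : R, e * e = e ∧ e * a = a ∧ a + (1 - e) ∈ R⁰

theorem IsFractionExtension.hasIdempotentSupports {A : Type u} {B : Type v} [CommRing A]
    [CommRing B] [Algebra A B] (hB : IsFractionExtension A B)
    (hreg : ∀ s ∈ A⁰, algebraMap A B s ∈ B⁰) (hA : HasIdempotentSupports A) :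
    HasIdempotentSupports B := by
  intro b
  obtain ⟨s, c, hs, hc⟩ := hB b
  obtain ⟨e, he, hec, hr⟩ := hA c
  have he' : algebraMap A B e * algebraMap A B e = algebraMap A B e := by rw [← map_mul, he]
  have hec' : algebraMap A B e * algebraMap A B c = algebraMap A B c := by rw [← map_mul, hec]
  have heb : algebraMap A B e * b = b := (mul_cancel_left_mem_nonZeroDivisors hs).1 (by
    linear_combination (algebraMap A B e - 1) * hc + hec')
  refine ⟨algebraMap A B e, he', heb, mem_nonZeroDivisors_iff_right.2 fun x hx => ?_⟩
  refine mem_nonZeroDivisors_iff_right.1 (hreg _ hr) x ?_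
  have hxb : x * b = 0 := by
    linear_combination algebraMap A B e * hx + x * he' - x * heb
  rw [map_add, ← hc, map_sub, map_one]
  linear_combination hx + (algebraMap A B s - 1) * hxb

theorem IsPruferExtension.hasIdempotentSupports {A : Type u} {B : Type v} [CommRing A]
    [CommRing B] [Algebra A B] (h : IsPruferExtension A B)
    (hinj : Function.Injective (algebraMap A B)) (hB : HasIdempotentSupports B) :
    HasIdempotentSupports A := by
  intro a
  obtain ⟨e, he, hea, hr⟩ := hB (algebraMap A B a)
  obtain ⟨e, he', rfl⟩ := h.exists_isIdempotentElem hinj he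
  refine ⟨e, he', hinj (by rw [map_mul, hea]), mem_nonZeroDivisors_of_algebraMap hinj ?_⟩
  rwa [map_add, map_sub, map_one]

/-! ### Elementwise forms of the Prüfer, flat and semihereditary conditions. -/

section Pruefer

variable {R : Type u} [CommRing R]

/-- If J inverts (a, s), write 1 = ax + sy with x, y ∈ J; then t = sy, and ay, sx lie in `R`. -/
theorem IsPruferRing.hasRegularComparability (h : IsPruferRing R) : HasRegularComparability R := by
  intro a s hs
  obtain ⟨J, hJ⟩ := (h (Ideal.span {a} ⊔ Ideal.span {s})
    ((Submodule.fg_span_singleton a).sup (Submodule.fg_span_singleton s))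
    ⟨s, Submodule.mem_sup_right (Ideal.mem_span_singleton_self s), hs⟩).exists_right_inv
  have hinj := IsFractionRing.injective R (FractionRing R)
  rw [FractionalIdeal.coeIdeal_sup, ← FractionalIdeal.sup_eq_add, FractionalIdeal.sup_eq_add,
    FractionalIdeal.coeIdeal_span_singleton, FractionalIdeal.coeIdeal_span_singleton] at hJ
  have key : ∀ x ∈ J, (∃ r : R, algebraMap R (FractionRing R) r = algebraMap R _ a * x) ∧
      ∃ r : R, algebraMap R (FractionRing R) r = algebraMap R _ s * x := by
    intro x hx
    constructor <;> rw [← FractionalIdeal.mem_one_iff R⁰, ← hJ] <;>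
      refine FractionalIdeal.mul_mem_mul ?_ hx
    · exact (FractionalIdeal.mem_add _ _ _).2 ⟨_, FractionalIdeal.mem_spanSingleton_self _ _, 0,
        FractionalIdeal.zero_mem _, add_zero _⟩
    · exact (FractionalIdeal.mem_add _ _ _).2 ⟨0, FractionalIdeal.zero_mem _, _,
        FractionalIdeal.mem_spanSingleton_self _ _, zero_add _⟩
  have h₁ : (1 : FractionRing R) ∈ (1 : FractionalIdeal R⁰ (FractionRing R)) :=
    FractionalIdeal.one_mem_one _
  rw [← hJ, add_mul, FractionalIdeal.mem_add] at h₁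
  obtain ⟨_, hx, _, hy, hxy⟩ := h₁
  obtain ⟨x, hxJ, rfl⟩ := FractionalIdeal.mem_singleton_mul.1 hx
  obtain ⟨y, hyJ, rfl⟩ := FractionalIdeal.mem_singleton_mul.1 hy
  obtain ⟨-, ⟨c, hc⟩⟩ := key x hxJ
  obtain ⟨⟨d, hd⟩, ⟨t, ht⟩⟩ := key y hyJ
  refine ⟨t, ⟨d, hinj ?_⟩, ⟨c, hinj ?_⟩⟩
  · simp only [map_mul, ht, hd]
    ring
  · simp only [map_mul, map_sub, map_one, ht, hc]
    linear_combination (-algebraMap R (FractionRing R) s) * hxy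

/-- Divisibility in the localization at a prime. -/
def DvdAtPrime (m : Ideal R) (a b : R) : Prop := ∃ u ∉ m, a ∣ u * b

theorem DvdAtPrime.refl (m : Ideal R) [m.IsPrime] (a : R) : DvdAtPrime m a a :=
  ⟨1, m.one_notMem, by simp⟩

theorem ComparableAt.dvdAtPrime_or {m : Ideal R} {u a b : R} (hu : u ∉ m)
    (h : ComparableAt u a b) : DvdAtPrime m b a ∨ DvdAtPrime m a b := by
  obtain ⟨t, h₁, h₂⟩ := h
  by_cases ht : t ∈ m
  · exact .inr ⟨u - t, fun h => hu (by simpa using m.add_mem h ht), h₂⟩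
  · exact .inl ⟨t, ht, h₁⟩

/-- A local divisor `g` of a regular `s` need not be regular in `R`. With us = gz, compare zb with
`s` instead and cancel `s`. -/
theorem HasRegularComparability.dvdAtPrime_or (h : HasRegularComparability R) {m : Ideal R}
    [hm : m.IsPrime] {s g b : R} (hs : s ∈ R⁰) (hg : DvdAtPrime m g s) :
    DvdAtPrime m b g ∨ DvdAtPrime m g b := by
  obtain ⟨u, hu, z, hz⟩ := hg
  obtain ⟨t, ⟨r, hr⟩, ⟨r', hr'⟩⟩ := h (z * b) s hs
  have h₁ : g * r = t * u * b := (mul_cancel_left_mem_nonZeroDivisors hs).1 (by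
    linear_combination (-g) * hr - t * b * hz)
  have h₂ : (1 - t) * g = b * (u * r') := (mul_cancel_left_mem_nonZeroDivisors hs).1 (by
    linear_combination g * hr' - b * r' * hz)
  by_cases ht : t ∈ m
  · exact .inl ⟨1 - t, fun h => m.one_notMem (by simpa using m.add_mem h ht), u * r', h₂⟩
  · exact .inr ⟨t * u, hm.mul_notMem ht hu, r, h₁.symm⟩

/-- Locally at `m` the ideal I + (s) is principal. Carrying the property that the generator divides
`s` through the induction is what allows two generators to be compared. -/
theorem HasRegularComparability.exists_dvdAtPrime (h : HasRegularComparability R) {m : Ideal R}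
    [hm : m.IsPrime] {s : R} (hs : s ∈ R⁰) (I : Ideal R) (hI : I.FG) :
    ∃ g ∈ I ⊔ Ideal.span {s}, DvdAtPrime m g s ∧ ∃ v ∉ m, ∀ i ∈ I, g ∣ v * i := by
  have hself := Ideal.mem_span_singleton_self s
  induction I, hI using Submodule.fg_induction with
  | singleton x =>
    rcases (h x s hs).dvdAtPrime_or m.one_notMem with ⟨v, hv, hd⟩ | h'
    · refine ⟨s, Submodule.mem_sup_right hself, .refl m s, v, hv, fun i hi => ?_⟩
      obtain ⟨c, rfl⟩ := Ideal.mem_span_singleton.1 hi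
      rw [← mul_assoc]
      exact hd.mul_right c
    · refine ⟨x, Submodule.mem_sup_left (Ideal.mem_span_singleton_self x), h', 1, m.one_notMem,
        fun i hi => ?_⟩
      rw [one_mul]
      exact Ideal.mem_span_singleton.1 hi
  | sup I₁ I₂ _ _ ih₁ ih₂ =>
    have key : ∀ {J₁ J₂ : Ideal R} {g₁ g₂ v₁ v₂ : R}, v₁ ∉ m → v₂ ∉ m →
        (∀ i ∈ J₁, g₁ ∣ v₁ * i) → (∀ i ∈ J₂, g₂ ∣ v₂ * i) → DvdAtPrime m g₁ g₂ →
        ∃ v ∉ m, ∀ i ∈ J₁ ⊔ J₂, g₁ ∣ v * i := by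
      rintro J₁ J₂ g₁ g₂ v₁ v₂ hv₁ hv₂ hd₁ hd₂ ⟨w, hw, c, hc⟩
      refine ⟨w * (v₁ * v₂), hm.mul_notMem hw (hm.mul_notMem hv₁ hv₂), fun i hi => ?_⟩
      obtain ⟨x, hx, y, hy, rfl⟩ := Submodule.mem_sup.1 hi
      obtain ⟨x', hx'⟩ := hd₁ x hx
      obtain ⟨y', hy'⟩ := hd₂ y hy
      exact ⟨w * v₂ * x' + v₁ * y' * c, by
        linear_combination w * v₂ * hx' + w * v₁ * hy' + v₁ * y' * hc⟩
    obtain ⟨g₁, hg₁, hs₁, v₁, hv₁, hd₁⟩ := ih₁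
    obtain ⟨g₂, hg₂, hs₂, v₂, hv₂, hd₂⟩ := ih₂
    rcases h.dvdAtPrime_or (b := g₂) hs hs₁ with h' | h'
    · rw [sup_comm I₁]
      exact ⟨g₂, sup_le_sup_right (le_sup_left : I₂ ≤ I₂ ⊔ I₁) (Ideal.span {s}) hg₂, hs₂,
        key hv₂ hv₁ hd₂ hd₁ h'⟩
    · exact ⟨g₁, sup_le_sup_right (le_sup_left : I₁ ≤ I₁ ⊔ I₂) (Ideal.span {s}) hg₁, hs₁,
        key hv₁ hv₂ hd₁ hd₂ h'⟩

theorem HasRegularComparability.isPruferRing (h : HasRegularComparability R) :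
    IsPruferRing R := by
  intro I hI ⟨s, hsI, hs⟩
  set K := FractionRing R
  let J₀ : Submodule R K := 1 / IsLocalization.coeSubmodule K I
  have hJ₀ : ∀ x, x ∈ J₀ ↔ ∀ i ∈ I, ∃ r : R, algebraMap R K r = x * algebraMap R K i := by
    intro x
    simp only [J₀, Submodule.mem_div_iff_forall_mul_mem, IsLocalization.mem_coeSubmodule,
      forall_exists_index, and_imp, Submodule.mem_one]
    aesop
  let J : FractionalIdeal R⁰ K := ⟨J₀, s, hs, fun x hx => by
    obtain ⟨r, hr⟩ := (hJ₀ x).1 hx s hsI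
    exact ⟨r, by rw [hr, Algebra.smul_def, mul_comm]⟩⟩
  refine IsUnit.of_mul_eq_one J (le_antisymm ?_ ?_)
  · rw [FractionalIdeal.mul_le]
    intro i hi x hx
    obtain ⟨i, hiI, rfl⟩ := (FractionalIdeal.mem_coeIdeal _).1 hi
    rw [FractionalIdeal.mem_one_iff, mul_comm]
    exact (hJ₀ x).1 hx i hiI
  · rw [FractionalIdeal.one_le]
    -- `P` is the ideal of `r` lying in IJ; it suffices that no maximal ideal contains it.
    let P : Ideal R := Submodule.comap (Algebra.linearMap R K)
      ((I : FractionalIdeal R⁰ K) * J : FractionalIdeal R⁰ K)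
    suffices P = ⊤ by
      have h1 : (1 : R) ∈ P := this ▸ Submodule.mem_top
      rwa [Submodule.mem_comap, Algebra.linearMap_apply, map_one] at h1
    by_contra hP
    obtain ⟨m, hm, hPm⟩ := Ideal.exists_le_maximal P hP
    obtain ⟨g, hg, -, v, hv, hvd⟩ := h.exists_dvdAtPrime (m := m) hs I hI
    rw [sup_eq_left.2 ((Ideal.span_singleton_le_iff_mem I).2 hsI)] at hg
    obtain ⟨z, hz⟩ := hvd s hsI
    have hsK : IsUnit (algebraMap R K s) := IsLocalization.map_units K (⟨s, hs⟩ : R⁰)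
    -- As vs = gz, the fraction zv/s plays the role of v²/g: it maps `I` into `R` and sends `g` to
    -- v².
    have hx : ∀ i w, v * i = g * w →
        algebraMap R K (v * w) = IsLocalization.mk' K (z * v) (⟨s, hs⟩ : R⁰) * algebraMap R K i := by
      intro i w hw
      refine hsK.mul_left_cancel ?_
      rw [← mul_assoc, IsLocalization.mk'_spec'_mk, ← map_mul, ← map_mul]
      congr 1
      linear_combination (-z) * hw + w * hz
    have hvv : v * v ∈ P := by
      change algebraMap R K (v * v) ∈ (I : FractionalIdeal R⁰ K) * J
      rw [hx g v (mul_comm _ _), mul_comm (IsLocalization.mk' K _ _)]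
      refine FractionalIdeal.mul_mem_mul (FractionalIdeal.mem_coeIdeal_of_mem _ hg) ?_
      refine (hJ₀ _).2 fun i hi => ?_
      obtain ⟨w, hw⟩ := hvd i hi
      exact ⟨_, hx i w hw⟩
    exact hm.isPrime.mul_notMem hv hv (hPm hvv)

theorem isPruferRing_iff : IsPruferRing R ↔ HasRegularComparability R :=
  ⟨fun h => h.hasRegularComparability, fun h => h.isPruferRing⟩

theorem IsPruferRing.projective (h : IsPruferRing R) {I : Ideal R} (hI : I.FG)
    (hreg : IsRegularIdeal I) : Module.Projective R I := by
  have hproj := Submodule.projective_of_isUnit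
    ((h I hI hreg).map (FractionalIdeal.coeSubmoduleHom R⁰ (FractionRing R)))
  let e : I ≃ₗ[R] IsLocalization.coeSubmodule (FractionRing R) I :=
    Submodule.equivMapOfInjective (Algebra.linearMap R (FractionRing R))
      (IsFractionRing.injective R (FractionRing R)) I
  exact @Module.Projective.of_equiv R R _ _ _ _ _ _ _ _ (RingHom.id R) (RingHom.id R) _ _
    e.symm hproj

/-- Distributivity from flatness of two-generated ideals. -/
theorem hasComparability_of_flat (h : ∀ I : Ideal R, I.FG → Module.Flat R I) :
    HasComparability R := by
  intro a b
  let I : Ideal R := Ideal.span {a, b}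
  have := h I (Submodule.fg_span (Set.toFinite _))
  let x : I := ⟨a, Ideal.subset_span (by simp)⟩
  let y : I := ⟨b, Ideal.subset_span (by simp)⟩
  -- Equational criterion for the relation b·a - a·b = 0 in the ideal (a, b).
  obtain ⟨k, c, z, hz, hc⟩ := Module.Flat.isTrivialRelation_of_sum_smul_eq_zero (R := R)
    (f := ![b, -a]) (x := ![x, y]) (by
      ext
      simp [x, y, mul_comm])
  have hz₀ : a = ∑ j, c 0 j * (z j : R) := by simpa [x] using congrArg Subtype.val (hz 0)
  have hz' : ∀ j, ∃ p q, p * a + q * b = (z j : R) := fun j => Ideal.mem_span_pair.1 (z j).2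
  choose p q hpq using hz'
  have hc' : ∀ j, b * c 0 j = a * c 1 j := fun j => by
    have := hc j
    simp only [Fin.sum_univ_two, Matrix.cons_val_zero, Matrix.cons_val_one] at this
    linear_combination this
  refine ⟨1 - ∑ j, c 0 j * p j, ⟨∑ j, c 0 j * q j, ?_⟩, ⟨∑ j, c 1 j * p j, ?_⟩⟩
  · rw [sub_mul, one_mul, sub_eq_iff_eq_add]
    conv_lhs => rw [hz₀]
    rw [Finset.mul_sum, Finset.sum_mul, ← Finset.sum_add_distrib]
    exact Finset.sum_congr rfl fun j _ => by rw [← hpq]; ring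
  · rw [sub_sub_cancel, Finset.mul_sum, Finset.sum_mul]
    exact Finset.sum_congr rfl fun j _ => by linear_combination p j * hc' j

theorem eq_zero_of_sq_eq_zero_of_flat (a : R) [Module.Flat R (Ideal.span {a})] (ha : a * a = 0) :
    a = 0 := by
  let x : Ideal.span {a} := ⟨a, Ideal.mem_span_singleton_self a⟩
  obtain ⟨k, c, z, hz, hc⟩ := Module.Flat.isTrivialRelation_of_sum_smul_eq_zero (R := R)
    (f := ![a]) (x := ![x]) (by
      ext
      simpa [x] using ha)
  have hz₀ : a = ∑ j, c 0 j * (z j : R) := by simpa [x] using congrArg Subtype.val (hz 0)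
  rw [hz₀]
  refine Finset.sum_eq_zero fun j _ => ?_
  obtain ⟨p, hp⟩ := Ideal.mem_span_singleton.1 (z j).2
  have := hc j
  simp only [Finset.univ_unique, Fin.default_eq_zero, Finset.sum_singleton,
    Matrix.cons_val_zero] at this
  rw [hp]
  linear_combination p * this

theorem IsSemihereditaryRing.hasComparability (h : IsSemihereditaryRing R) : HasComparability R :=
  hasComparability_of_flat fun I hI => by
    have := h I hI
    infer_instance

/-- A splitting σ of R → (a) gives the idempotent σ(a), which is killed by everything that kills
`a`. -/
theorem IsSemihereditaryRing.hasIdempotentSupports (h : IsSemihereditaryRing R) :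
    HasIdempotentSupports R := by
  intro a
  have := h (Ideal.span {a}) (Submodule.fg_span_singleton a)
  let x : Ideal.span {a} := ⟨a, Ideal.mem_span_singleton_self a⟩
  obtain ⟨σ, hσ⟩ := Module.projective_lifting_property (LinearMap.toSpanSingleton R _ x)
    LinearMap.id (fun y => by
      obtain ⟨c, hc⟩ := Ideal.mem_span_singleton.1 y.2
      exact ⟨c, Subtype.ext (by simp [x, hc, mul_comm])⟩)
  have hx : σ x • x = x := by simpa using LinearMap.congr_fun hσ x
  have he : σ x * σ x = σ x := by simpa using congrArg σ hx
  have ha : σ x * a = a := by simpa [x] using congrArg Subtype.val hx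
  refine ⟨σ x, he, ha, mem_nonZeroDivisors_iff_right.2 fun y hy => ?_⟩
  have hya : y * a = 0 := by linear_combination σ x * hy + y * he - y * ha
  have hye : y * σ x = 0 := by
    rw [← smul_eq_mul, ← map_smul, show y • x = 0 from Subtype.ext hya, map_zero]
  linear_combination hy - hya + hye

/-- One element can carry the support of the whole ideal: add to `a` the part of `b` off the support
`e`. -/
theorem HasIdempotentSupports.exists_regular (h : HasIdempotentSupports R) (I : Ideal R)
    (hI : I.FG) :
    ∃ e : R, e * e = e ∧ (∀ i ∈ I, e * i = i) ∧ ∃ i ∈ I, i + (1 - e) ∈ R⁰ := by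
  induction I, hI using Submodule.fg_induction with
  | singleton a =>
    obtain ⟨e, he, hea, hr⟩ := h a
    refine ⟨e, he, fun i hi => ?_, a, Ideal.mem_span_singleton_self a, hr⟩
    obtain ⟨c, rfl⟩ := Ideal.mem_span_singleton.1 hi
    rw [← mul_assoc, hea]
  | sup I₁ I₂ _ _ ih₁ ih₂ =>
    obtain ⟨e, he, heI, a, ha, hra⟩ := ih₁
    obtain ⟨f, hf, hfI, b, hb, hrb⟩ := ih₂
    refine ⟨e + f - e * f, ?_, fun i hi => ?_, a + (1 - e) * b,
      Submodule.add_mem_sup ha (I₂.smul_mem _ hb),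
      mem_nonZeroDivisors_iff_right.2 fun x hx => ?_⟩
    · linear_combination (1 - f) ^ 2 * he + (1 - e) * hf
    · obtain ⟨y, hy, z, hz, rfl⟩ := Submodule.mem_sup.1 hi
      linear_combination (1 - f) * heI y hy + (1 - e) * hfI z hz
    · have hea := heI a ha
      have h₁ : x * a = 0 := by
        linear_combination e * hx - x * hea + x * (b + 1 - f) * he
      have h₂ : x * e = 0 := mem_nonZeroDivisors_iff_right.1 hra _ (by
        linear_combination h₁ + x * hea - x * he)
      refine mem_nonZeroDivisors_iff_right.1 hrb _ ?_
      linear_combination hx - h₁ + (b + 1 - f) * h₂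

/-- If `e` supports `I`, then I + (1 - e) is regular, hence projective, and multiplication by `e`
retracts it onto `I`. -/
theorem isSemihereditaryRing_iff :
    IsSemihereditaryRing R ↔ HasRegularComparability R ∧ HasIdempotentSupports R := by
  refine ⟨fun h => ⟨h.hasComparability.hasRegularComparability, h.hasIdempotentSupports⟩,
    fun ⟨h, h'⟩ I hI => ?_⟩
  obtain ⟨e, he, heI, i, hi, hr⟩ := h'.exists_regular I hI
  have hJ := h.isPruferRing.projective (Submodule.FG.sup hI (Submodule.fg_span_singleton (1 - e)))
    ⟨i + (1 - e), Submodule.add_mem_sup hi (Ideal.mem_span_singleton_self _), hr⟩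
  have hle : I ≤ I ⊔ Ideal.span {1 - e} := le_sup_left
  refine Module.Projective.of_split (Submodule.inclusion hle)
    (((LinearMap.mulLeft R e).restrict (q := I) fun x hx => ?_)) ?_
  · obtain ⟨y, hy, z, hz, rfl⟩ := Submodule.mem_sup.1 hx
    obtain ⟨c, rfl⟩ := Ideal.mem_span_singleton.1 hz
    rw [LinearMap.mulLeft_apply, show e * (y + (1 - e) * c) = e * y by
      linear_combination (-c) * he]
    exact I.mul_mem_left _ hy
  · ext x
    simp [heI x x.2]

/-- The relation a·1 = 0 in the flat module R/(a) is trivial, so 1 is congruent modulo `a` to an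
element killed by `a`. -/
theorem IsAbsolutelyFlat.exists_eq_mul_mul (h : IsAbsolutelyFlat R) (a : R) :
    ∃ y, a = a * a * y := by
  have := h (R ⧸ Ideal.span {a})
  obtain ⟨k, c, z, hz, hc⟩ := Module.Flat.isTrivialRelation_of_sum_smul_eq_zero (R := R)
    (f := ![a]) (x := ![(1 : R ⧸ Ideal.span {a})]) (by
      simp [Algebra.smul_def, Ideal.Quotient.algebraMap_eq])
  choose y hy using fun j => Ideal.Quotient.mk_surjective (z j)
  have hz₀ : Ideal.Quotient.mk (Ideal.span {a}) 1 = Ideal.Quotient.mk _ (∑ j, c 0 j * y j) := by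
    have := hz 0
    simp only [Matrix.cons_val_zero, ← hy] at this
    rw [map_one, this, map_sum]
    rfl
  rw [Ideal.Quotient.eq, Ideal.mem_span_singleton] at hz₀
  obtain ⟨d, hd⟩ := hz₀
  refine ⟨d, ?_⟩
  have : a * ∑ j, c 0 j * y j = 0 := by
    rw [Finset.mul_sum]
    refine Finset.sum_eq_zero fun j _ => ?_
    have := hc j
    simp only [Finset.univ_unique, Fin.default_eq_zero, Finset.sum_singleton,
      Matrix.cons_val_zero] at this
    linear_combination y j * this
  linear_combination a * hd + this

/-- In Tot(R) the idempotent ay with a = a²y supports `a`; supports descend because R ⊆ Tot(R) is a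
Prüfer extension. -/
theorem HasRegularComparability.hasIdempotentSupports (h : HasRegularComparability R)
    (hR : IsAbsolutelyFlat (FractionRing R)) : HasIdempotentSupports R := by
  have hinj := IsFractionRing.injective R (FractionRing R)
  refine (h.isPruferExtension hinj
    (isFractionExtension_of_isFractionRing (B := FractionRing R))).hasIdempotentSupports hinj ?_
  intro a
  obtain ⟨y, hy⟩ := hR.exists_eq_mul_mul a
  have he : (a * y) * (a * y) = a * y := by linear_combination (-y) * hy
  refine ⟨a * y, he, by linear_combination -hy, mem_nonZeroDivisors_iff_right.2 fun x hx => ?_⟩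
  have hxa : x * a = 0 := by linear_combination a * y * hx + (x - x * y) * hy
  linear_combination hx + (y - 1) * hxa

end Pruefer

/-! ### Localization and weak global dimension. -/

theorem HasComparability.of_isLocalization {R : Type u} [CommRing R] (h : HasComparability R)
    (M : Submonoid R) (L : Type v) [CommRing L] [Algebra R L] [IsLocalization M L] :
    HasComparability L := by
  intro x y
  obtain ⟨⟨a, s⟩, hx⟩ := IsLocalization.surj M x
  obtain ⟨⟨b, s'⟩, hy⟩ := IsLocalization.surj M y
  obtain ⟨u, hu⟩ := IsLocalization.map_units L s
  obtain ⟨v, hv⟩ := IsLocalization.map_units L s'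
  obtain ⟨t, ⟨r, hr⟩, ⟨d, hd⟩⟩ := h a b
  replace hr := congrArg (algebraMap R L) hr
  replace hd := congrArg (algebraMap R L) hd
  dsimp only at hx hy
  simp only [map_mul, map_sub, map_one, ← hx, ← hy, ← hu, ← hv] at hr hd
  refine ⟨algebraMap R L t, ⟨v * algebraMap R L r * ↑u⁻¹, ?_⟩,
    ⟨u * algebraMap R L d * ↑v⁻¹, ?_⟩⟩
  · rw [← mul_assoc, Units.eq_mul_inv_iff_mul_eq]
    linear_combination hr
  · rw [← mul_assoc, Units.eq_mul_inv_iff_mul_eq]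
    linear_combination hd

theorem HasComparability.dvd_total {R : Type u} [CommRing R] [IsLocalRing R]
    (h : HasComparability R) (a b : R) : a ∣ b ∨ b ∣ a := by
  obtain ⟨t, h₁, h₂⟩ := h a b
  rcases IsLocalRing.isUnit_or_isUnit_one_sub_self t with ht | ht
  · exact .inr (ht.dvd_mul_left.1 h₁)
  · exact .inl (ht.dvd_mul_left.1 h₂)

/-- Locally divisibility is total, and reducedness then gives a valuation domain, over which
torsion-free modules are flat. -/
theorem HasComparability.hasWeakGlobalDimLEOne {R : Type u} [CommRing R]
    (h : HasComparability R) [IsReduced R] : HasWeakGlobalDimLEOne R := by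
  intro I
  refine Module.flat_of_localized_maximal (R := R) (M := I) fun P hP => ?_
  let L := Localization P.primeCompl
  have hL := h.of_isLocalization P.primeCompl L
  have : IsReduced L := isReduced_localizationPreserves P.primeCompl _ ‹_›
  have : NoZeroDivisors L := ⟨fun {a b} hab => by
    rcases hL.dvd_total a b with ⟨c, rfl⟩ | ⟨c, rfl⟩
    · exact .inr (by
        refine IsReduced.eq_zero _ ⟨2, ?_⟩
        linear_combination c * hab)
    · exact .inl (by
        refine IsReduced.eq_zero _ ⟨2, ?_⟩
        linear_combination c * hab)⟩
  have : IsDomain L := NoZeroDivisors.to_isDomain L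
  have : ValuationRing L := ValuationRing.iff_dvd_total.2 ⟨hL.dvd_total⟩
  suffices Module.Flat L (LocalizedModule P.primeCompl I) from
    Module.Flat.trans R L _
  rw [Module.Flat.flat_iff_torsion_eq_bot_of_isBezout, ← Submodule.isTorsionFree_iff_torsion_eq_bot]
  exact (LocalizedModule.map_injective P.primeCompl I.subtype
    I.subtype_injective).moduleIsTorsionFree _ (map_smul _)

theorem hasWeakGlobalDimLEOne_iff {R : Type u} [CommRing R] :
    HasWeakGlobalDimLEOne R ↔ HasComparability R ∧ IsReduced R := by
  refine ⟨fun h => ⟨hasComparability_of_flat fun I _ => h I, ?_⟩,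
    fun ⟨h, h'⟩ => h.hasWeakGlobalDimLEOne⟩
  refine isReduced_iff_pow_one_lt 2 one_lt_two |>.2 fun a ha => ?_
  have := h (Ideal.span {a})
  exact eq_zero_of_sq_eq_zero_of_flat a (by rw [← sq, ha])

/-! ### The pullback square. -/

section Pullback

variable {B : Type u} {T : Type v} [CommRing B] [CommRing T] {π : B →+* T} {R : Subring T}

theorem algebraMap_comap_injective : Function.Injective (algebraMap (R.comap π) B) :=
  Subtype.val_injective

theorem exists_comap_eq_algebraMap (hπ : Function.Surjective π) (r : R) :
    ∃ a : R.comap π, π (a : B) = r := by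
  obtain ⟨b, hb⟩ := hπ r
  exact ⟨⟨b, by simp [Subring.mem_comap, hb]⟩, hb⟩

theorem mem_comap_of_mem_ker {b : B} (hb : b ∈ RingHom.ker π) : b ∈ R.comap π := by
  rw [Subring.mem_comap, (RingHom.mem_ker).1 hb]
  exact R.zero_mem

theorem isFractionExtension_comap (hker : IsRegularIdeal (RingHom.ker π)) :
    IsFractionExtension (R.comap π) B := by
  obtain ⟨s, hs, hs'⟩ := hker
  exact fun y => ⟨⟨s, mem_comap_of_mem_ker hs⟩,
    ⟨s * y, mem_comap_of_mem_ker (Ideal.mul_mem_right _ _ hs)⟩, hs', rfl⟩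

theorem mem_nonZeroDivisors_of_comap (hker : IsRegularIdeal (RingHom.ker π)) (a : R.comap π)
    (ha : a ∈ (R.comap π)⁰) : algebraMap (R.comap π) B a ∈ B⁰ := by
  obtain ⟨s, hs, hs'⟩ := hker
  rw [mem_nonZeroDivisors_iff_right] at *
  intro x hx
  have h := ha ⟨x * s, mem_comap_of_mem_ker (Ideal.mul_mem_left _ _ hs)⟩ (Subtype.ext (by
    change x * s * algebraMap (R.comap π) B a = 0
    linear_combination s * hx))
  exact hs' x (congrArg Subtype.val h)

/-- A subring extension is Prüfer iff its pullback along a surjection is. -/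
theorem isPruferExtension_comap_iff (hπ : Function.Surjective π) :
    IsPruferExtension (R.comap π) B ↔ IsPruferExtension R T := by
  constructor
  · intro h y
    obtain ⟨y, rfl⟩ := hπ y
    obtain ⟨t, d, r, h₁, h₂⟩ := h y
    refine ⟨⟨π t, t.2⟩, ⟨π d, d.2⟩, ⟨π r, r.2⟩, ?_, ?_⟩
    · simpa using! congrArg π h₁
    · simpa using! congrArg π h₂
  · intro h y
    obtain ⟨t, d, r, h₁, h₂⟩ := h (π y)
    obtain ⟨t', ht⟩ := exists_comap_eq_algebraMap hπ t
    obtain ⟨d', hd⟩ := exists_comap_eq_algebraMap hπ d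
    have h₃ : π (1 - y * d') = t := by
      rw [map_sub, map_one, map_mul, hd]
      change 1 - π y * algebraMap R T d = algebraMap R T t
      rw [map_sub, map_one] at h₂
      linear_combination h₂
    have h₄ : π ((1 - y * d') * y) = r := by
      rw [map_mul, h₃]
      exact h₁
    refine ⟨⟨1 - y * d', by rw [Subring.mem_comap, h₃]; exact t.2⟩, d',
      ⟨(1 - y * d') * y, by rw [Subring.mem_comap, h₄]; exact r.2⟩, rfl, ?_⟩
    change 1 - (1 - y * (d' : B)) = y * d'
    ring

/-- A lift s' of a regular `s` need not be regular, so both comparisons are made with a regular β ∈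
ker π. The first gives (1 - t)β = s'r', where `t` dies in `R` because `s` is regular; the second
compares a'r' with β, and cancelling β relates a' to s'. -/
theorem HasRegularComparability.of_comap (hπ : Function.Surjective π)
    (hker : IsRegularIdeal (RingHom.ker π)) (h : HasRegularComparability (R.comap π)) :
    HasRegularComparability R := by
  obtain ⟨b, hb, hb'⟩ := hker
  intro a s hs
  obtain ⟨a', ha⟩ := exists_comap_eq_algebraMap hπ a
  obtain ⟨s', hs'⟩ := exists_comap_eq_algebraMap hπ s
  let β : R.comap π := ⟨b, mem_comap_of_mem_ker hb⟩
  have hβ : β ∈ (R.comap π)⁰ := mem_nonZeroDivisors_of_algebraMap algebraMap_comap_injective hb'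
  let φ : R.comap π →+* R := (π.comp (R.comap π).subtype).codRestrict R fun x => x.2
  have hφβ : φ β = 0 := Subtype.ext hb
  have hφa : φ a' = a := Subtype.ext ha
  have hφs : φ s' = s := Subtype.ext hs'
  obtain ⟨t, ⟨r, hr⟩, ⟨r', hr'⟩⟩ := h s' β hβ
  have ht : φ t = 0 := by
    refine mem_nonZeroDivisors_iff_right.1 hs _ ?_
    rw [← hφs, ← map_mul, hr, map_mul, hφβ, zero_mul]
  obtain ⟨τ, ⟨c, hc⟩, ⟨d, hd⟩⟩ := h (a' * r') β hβ
  have h₁ : τ * (1 - t) * a' = c * s' := (mul_cancel_left_mem_nonZeroDivisors hβ).1 (by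
    linear_combination τ * a' * hr' + s' * hc)
  have h₂ : (1 - τ) * s' = a' * d * (1 - t) := (mul_cancel_left_mem_nonZeroDivisors hβ).1 (by
    linear_combination s' * hd - a' * d * hr')
  replace h₁ := congrArg φ h₁
  replace h₂ := congrArg φ h₂
  simp only [map_mul, map_sub, map_one, ht, hφa, hφs] at h₁ h₂
  exact ⟨φ τ, ⟨φ c, by linear_combination h₁⟩, ⟨φ d, by linear_combination h₂⟩⟩

end Pullback

/-! ### Overrings. -/

section Overring

variable {R : Type u} {T : Type v} [CommRing R] [CommRing T] [Algebra R T]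

theorem IsOverring.injective (h : IsOverring R T) : Function.Injective (algebraMap R T) := by
  obtain ⟨f, -⟩ := h
  refine Function.Injective.of_comp (f := f) ?_
  convert IsFractionRing.injective R (FractionRing R)
  ext x
  simp

theorem IsOverring.isFractionExtension (h : IsOverring R T) : IsFractionExtension R T := by
  obtain ⟨f, hf⟩ := h
  intro y
  obtain ⟨s, c, hs, hc⟩ := isFractionExtension_of_isFractionRing (A := R) (f y)
  rw [← f.commutes, ← f.commutes, ← map_mul] at hc
  refine ⟨s, c, mem_nonZeroDivisors_iff_right.2 fun x hx => ?_, hf hc⟩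
  refine (injective_iff_map_eq_zero f).1 hf x (mem_nonZeroDivisors_iff_right.1 hs _ ?_)
  rw [← f.commutes, ← map_mul, hx, map_zero]

/-- Under these hypotheses the localization of `T` at the regular elements of `R` is again a total
ring of fractions of `R`. -/
theorem isOverring_of_forall_exists
    (hreg : ∀ s ∈ R⁰, algebraMap R T s ∈ T⁰)
    (h : ∀ y : T, ∃ s ∈ R⁰, ∃ c, algebraMap R T s * y = algebraMap R T c)
    (hinj : Function.Injective (algebraMap R T)) : IsOverring R T := by
  let M := Algebra.algebraMapSubmonoid T R⁰
  let Q := Localization M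
  have hM : M ≤ T⁰ := by
    rintro _ ⟨s, hs, rfl⟩
    exact hreg s hs
  have hTQ : Function.Injective (algebraMap T Q) := IsLocalization.injective Q hM
  have hRQ : Function.Injective (algebraMap R Q) := by
    rw [IsScalarTower.algebraMap_eq R T Q]
    exact hTQ.comp hinj
  have : IsLocalization R⁰ Q :=
    { map_units := fun s => by
        rw [IsScalarTower.algebraMap_apply R T Q]
        exact IsLocalization.map_units Q (⟨_, s, s.2, rfl⟩ : M)
      surj := fun z => by
        obtain ⟨⟨y, ⟨_, s, hs, rfl⟩⟩, hz⟩ := IsLocalization.surj M z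
        obtain ⟨s', hs', c, hc⟩ := h y
        refine ⟨⟨c, ⟨s * s', mul_mem hs hs'⟩⟩, ?_⟩
        dsimp only at hz ⊢
        rw [IsScalarTower.algebraMap_apply R T Q c, ← hc, map_mul, map_mul, ← hz,
          IsScalarTower.algebraMap_apply R T Q s, IsScalarTower.algebraMap_apply R T Q s']
        ring
      exists_of_eq := fun {x y} hxy => ⟨1, by rw [hRQ hxy]⟩ }
  exact ⟨(IsLocalization.algEquiv R⁰ Q (FractionRing R)).toAlgHom.comp
    (IsScalarTower.toAlgHom R T Q), (IsLocalization.algEquiv R⁰ Q (FractionRing R)).injective.comp hTQ⟩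

theorem IsPruferExtension.isOverring (h : IsPruferExtension R T)
    (hinj : Function.Injective (algebraMap R T)) (hR : HasIdempotentSupports R) :
    IsOverring R T := by
  have key : ∀ y : T, ∃ s ∈ R⁰, ∃ c, algebraMap R T s * y = algebraMap R T c := by
    intro y
    obtain ⟨t, d, r, h₁, h₂⟩ := h y
    obtain ⟨e, he, het, hr⟩ := hR t
    -- The denominator `t` may be a zero divisor. Off its support `e` one has yd = 1, so `d` serves
    -- as denominator there.
    refine ⟨t + d * (1 - e), mem_nonZeroDivisors_iff_right.2 fun x hx => ?_,
      r + (1 - e), ?_⟩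
    · have h₃ : x * t = 0 := by linear_combination e * hx + x * d * he - x * het
      have h₄ : x * e = 0 := mem_nonZeroDivisors_iff_right.1 hr _ (by
        linear_combination h₃ + x * het - x * he)
      have h₅ : x * d = 0 := by linear_combination hx - h₃ + d * h₄
      refine hinj ?_
      replace h₃ := congrArg (algebraMap R T) h₃
      replace h₅ := congrArg (algebraMap R T) h₅
      simp only [map_mul, map_sub, map_one, map_zero] at *
      linear_combination h₃ + y * h₅ + algebraMap R T x * h₂
    · replace he := congrArg (algebraMap R T) he
      replace het := congrArg (algebraMap R T) het
      simp only [map_mul, map_sub, map_one, map_add] at *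
      linear_combination h₁ - (1 - algebraMap R T e) * h₂ + het
  refine isOverring_of_forall_exists (fun s hs => mem_nonZeroDivisors_iff_right.2 fun x hx => ?_)
    key hinj
  obtain ⟨t, d, r, h₁, h₂⟩ := h x
  have h₃ : (1 - t) * s = 0 := hinj (by
    rw [map_mul, h₂, map_zero]
    linear_combination algebraMap R T d * hx)
  have h₄ := mem_nonZeroDivisors_iff_right.1 hs _ h₃
  have h₅ : r * s = 0 := hinj (by
    rw [map_mul, ← h₁, map_zero]
    linear_combination algebraMap R T t * hx)
  have h₆ := mem_nonZeroDivisors_iff_right.1 hs _ h₅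
  rw [h₆, ← sub_eq_zero.1 h₄, map_one, map_zero, one_mul] at h₁
  exact h₁

end Overring

/-! ### Gaussian rings. -/

section Gaussian

open Polynomial

variable {R : Type u} [CommRing R]

theorem isGaussianRing_iff :
    IsGaussianRing R ↔ ∀ (f g : R[X]) (i j : ℕ), f.coeff i * g.coeff j ∈ (f * g).contentIdeal := by
  constructor
  · intro h f g i j
    rw [← h f g]
    exact Ideal.mul_mem_mul (coeff_mem_contentIdeal f i) (coeff_mem_contentIdeal g j)
  · intro h f g
    refine le_antisymm ?_ (contentIdeal_mul_le_mul_contentIdeal f g)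
    rw [contentIdeal_def, contentIdeal_def g, Ideal.span_mul_span', Ideal.span_le]
    rintro _ ⟨x, hx, y, hy, rfl⟩
    obtain ⟨i, -, rfl⟩ := mem_coeffs_iff.1 hx
    obtain ⟨j, -, rfl⟩ := mem_coeffs_iff.1 hy
    exact h f g i j

theorem contentIdeal_le_iff {f : R[X]} {I : Ideal R} :
    f.contentIdeal ≤ I ↔ f ∈ I.map (C : R →+* R[X]) := by
  rw [Ideal.mem_map_C_iff]
  refine ⟨fun h n => h (coeff_mem_contentIdeal f n), fun h => ?_⟩
  rw [contentIdeal_def, Ideal.span_le]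
  intro x hx
  obtain ⟨i, -, rfl⟩ := mem_coeffs_iff.1 hx
  exact h i

theorem IsGaussianRing.coeff_mul_coeff_mem (h : IsGaussianRing R) {f g : R[X]} {I : Ideal R}
    (hfg : f * g ∈ I.map (C : R →+* R[X])) (i j : ℕ) : f.coeff i * g.coeff j ∈ I :=
  contentIdeal_le_iff.2 hfg (isGaussianRing_iff.1 h f g i j)

/-- Comes from (aX + b)(aX - b) = a²X² - b². -/
theorem IsGaussianRing.exists_mul_eq (h : IsGaussianRing R) (a b : R) :
    ∃ u v, a * b = u * (a * a) + v * (b * b) := by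
  have hfg : (C a * X + C b) * (C a * X - C b) ∈
      (Ideal.span {a * a, b * b}).map (C : R →+* R[X]) := by
    rw [show (C a * X + C b) * (C a * X - C b) = X ^ 2 * C (a * a) - C (b * b) by
      simp only [C_mul]
      ring]
    exact sub_mem (Ideal.mul_mem_left _ _ (Ideal.mem_map_of_mem _ (Ideal.subset_span (by simp))))
      (Ideal.mem_map_of_mem _ (Ideal.subset_span (by simp)))
  have := h.coeff_mul_coeff_mem hfg 1 0
  simp only [coeff_add, coeff_sub, coeff_C_mul, coeff_X_one, mul_one, coeff_C_succ, coeff_C_zero,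
    coeff_X_zero, mul_zero, add_zero, zero_sub, mul_neg, neg_mem_iff] at this
  obtain ⟨u, v, huv⟩ := Ideal.mem_span_pair.1 this
  exact ⟨u, v, huv.symm⟩

/-- The two linear factors are chosen so that their product is b²(X² - X + uv). -/
theorem IsGaussianRing.sq_dvd (h : IsGaussianRing R) {a b u v : R}
    (huv : a * b = u * (a * a) + v * (b * b)) : b * b ∣ u * (a * b) := by
  have hfg : (C b * X - C (u * a)) * (C b * X - C (b - u * a)) ∈
      (Ideal.span {b * b}).map (C : R →+* R[X]) := by
    rw [show (C b * X - C (u * a)) * (C b * X - C (b - u * a)) =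
      (X ^ 2 - X + C (u * v)) * C (b * b) by
        have := congrArg (C : R →+* R[X]) huv
        simp only [C_mul, C_add, C_sub] at this ⊢
        linear_combination C u * this]
    exact Ideal.mul_mem_left _ _ (Ideal.mem_map_of_mem _ (Ideal.mem_span_singleton_self _))
  have := h.coeff_mul_coeff_mem hfg 0 1
  simp only [coeff_sub, coeff_C_mul, coeff_X_one, mul_one, coeff_C_succ, coeff_C_zero,
    coeff_X_zero, mul_zero, sub_zero, zero_sub, neg_mul, neg_mem_iff] at this
  convert Ideal.mem_span_singleton.1 this using 1
  ring

theorem IsGaussianRing.hasRegularComparability (h : IsGaussianRing R) :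
    HasRegularComparability R := by
  intro a s hs
  obtain ⟨u, v, huv⟩ := h.exists_mul_eq a s
  obtain ⟨p, hp⟩ := h.sq_dvd huv
  have h₁ : u * a = p * s := (mul_cancel_left_mem_nonZeroDivisors hs).1 (by linear_combination hp)
  have h₂ : (1 - p) * a = s * v := (mul_cancel_left_mem_nonZeroDivisors hs).1 (by
    linear_combination huv + a * h₁)
  exact ⟨1 - p, ⟨v, h₂⟩, ⟨u, by linear_combination -h₁⟩⟩

/-- `b` is a multiple of `a` up to an element of square zero annihilated by `a`. -/
def IsGaussDominated (a b : R) : Prop := ∃ y, a * (b - y * a) = 0 ∧ (b - y * a) * (b - y * a) = 0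

theorem IsGaussianRing.isGaussDominated (h : IsGaussianRing R) {a b : R} (h₁ : a * a ∣ a * b)
    (h₂ : a * a ∣ b * b) : IsGaussDominated a b := by
  obtain ⟨y, hy⟩ := h₁
  obtain ⟨z, hz⟩ := h₂
  set n := b - y * a with hn
  have han : a * n = 0 := by linear_combination hy
  have hnn : n * n = (z - y * y) * (a * a) := by linear_combination hz - 2 * y * hy
  refine ⟨y, han, ?_⟩
  -- This product vanishes since an = 0 and n² = (z - y²)a²; its coefficients n and -n then give n²
  -- = 0.
  have hfg : (C ((z - y * y) * a) * X + C n) * (C a - C n * X) ∈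
      (⊥ : Ideal R).map (C : R →+* R[X]) := by
    have e₁ := congrArg (C : R →+* R[X]) han
    have e₂ := congrArg (C : R →+* R[X]) hnn
    simp only [C_mul, C_0] at e₁ e₂ ⊢
    rw [Ideal.map_bot, Ideal.mem_bot]
    linear_combination (1 - C (z - y * y) * X ^ 2) * e₁ - X * e₂
  have := h.coeff_mul_coeff_mem hfg 0 1
  simpa using this

theorem IsGaussianRing.sq_dvd_or [IsLocalRing R] (h : IsGaussianRing R) (a b : R) :
    (b * b ∣ b * a ∧ b * b ∣ a * a) ∨ (a * a ∣ a * b ∧ a * a ∣ b * b) ∨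
      ∃ u ∈ IsLocalRing.maximalIdeal R, ∃ v ∈ IsLocalRing.maximalIdeal R,
        a * b = u * (a * a) + v * (b * b) := by
  obtain ⟨u, v, huv⟩ := h.exists_mul_eq a b
  have key : ∀ {a b u v : R}, IsUnit u → a * b = u * (a * a) + v * (b * b) →
      b * b ∣ b * a ∧ b * b ∣ a * a := by
    intro a b u v hu huv
    have h₁ := hu.dvd_mul_left.1 (h.sq_dvd huv)
    refine ⟨mul_comm a b ▸ h₁, hu.dvd_mul_left.1 ?_⟩
    rw [← sub_eq_iff_eq_add] at huv
    exact huv ▸ dvd_sub h₁ (dvd_mul_left _ _)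
  by_cases hu : IsUnit u
  · exact .inl (key hu huv)
  by_cases hv : IsUnit v
  · exact .inr (.inl (key hv (u := v) (v := u) (by linear_combination huv)))
  · exact .inr (.inr ⟨u, hu, v, hv, huv⟩)

theorem IsGaussianRing.isGaussDominated_or [IsLocalRing R] (h : IsGaussianRing R) (a b : R) :
    IsGaussDominated a b ∨ IsGaussDominated b a := by
  have hunit : ∀ {w : R}, w ∈ IsLocalRing.maximalIdeal R → IsUnit (1 - w) := fun hw =>
    IsLocalRing.isUnit_one_sub_self_of_mem_nonunits _ hw
  rcases h.sq_dvd_or a b with ⟨h₁, h₂⟩ | ⟨h₁, h₂⟩ | ⟨u, hu, v, hv, huv⟩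
  · exact .inr (h.isGaussDominated h₁ h₂)
  · exact .inl (h.isGaussDominated h₁ h₂)
  have left : a * a ∣ b * b → IsGaussDominated a b ∨ IsGaussDominated b a := fun hd =>
    .inl (h.isGaussDominated (huv ▸ dvd_add (dvd_mul_left _ _) (hd.mul_left _)) hd)
  have right : b * b ∣ a * a → IsGaussDominated a b ∨ IsGaussDominated b a := fun hd =>
    .inr (h.isGaussDominated
      (mul_comm a b ▸ huv ▸ dvd_add (hd.mul_left _) (dvd_mul_left _ _)) hd)
  rcases h.sq_dvd_or (a + b) b with ⟨⟨p, hp⟩, q, hq⟩ | ⟨-, r, hr⟩ | ⟨u', hu', v', hv', huv'⟩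
  · exact right ⟨q - 2 * (p - 1) - 1, by linear_combination hq - 2 * hp⟩
  · by_cases hr' : IsUnit r
    · have h₁ : IsUnit (r * (1 - -(2 * u))) :=
        hr'.mul (hunit (neg_mem (Ideal.mul_mem_left _ _ hu)))
      refine right (h₁.dvd_mul_left.1 ⟨1 - r - 2 * r * v, ?_⟩)
      linear_combination (-1) * hr - 2 * r * huv
    · have h₁ : IsUnit (1 - (r + 2 * r * v)) :=
        hunit (add_mem hr' (Ideal.mul_mem_left _ _ hv))
      refine left (h₁.dvd_mul_left.1 ⟨r * (1 + 2 * u), ?_⟩)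
      linear_combination hr + 2 * r * huv
  · have h₁ : IsUnit (1 - (u' + 2 * v * u' + v' - v)) :=
      hunit (sub_mem (add_mem (add_mem hu' (Ideal.mul_mem_left _ _ hu')) hv') hv)
    refine left (h₁.dvd_mul_left.1 ⟨u' + 2 * u' * u - u, ?_⟩)
    linear_combination huv' - (1 - 2 * u') * huv

theorem mul_eq_zero_of_isGaussDominated_or {n m : R}
    (h : IsGaussDominated n m ∨ IsGaussDominated m n) (hn : n * n = 0) (hm : m * m = 0) :
    n * m = 0 := by
  rcases h with ⟨y, hy, -⟩ | ⟨y, hy, -⟩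
  · linear_combination hy + y * hn
  · linear_combination hy + y * hm

theorem IsGaussDominated.trans (h : ∀ a b : R, IsGaussDominated a b ∨ IsGaussDominated b a)
    {a b c : R} (hab : IsGaussDominated a b) (hbc : IsGaussDominated b c) :
    IsGaussDominated a c := by
  obtain ⟨y, h₁, h₂⟩ := hab
  obtain ⟨x, -, h₄⟩ := hbc
  set n := b - y * a
  set m := c - x * b with hm
  have hc : c = x * y * a + x * n + m := by ring
  clear_value m n
  rcases h a m with ⟨w, h₅, h₆⟩ | ⟨w, h₅, h₆⟩
  · have h₇ := mul_eq_zero_of_isGaussDominated_or (h _ _) h₂ h₆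
    refine ⟨x * y + w, ?_, ?_⟩
    · rw [hc]
      linear_combination x * h₁ + h₅
    · rw [hc]
      linear_combination x ^ 2 * h₂ + h₆ + 2 * x * h₇
  · have h₇ := mul_eq_zero_of_isGaussDominated_or (h _ _) h₂ h₄
    have ha : a * m = 0 := by linear_combination h₅ + w * h₄
    refine ⟨x * y, ?_, ?_⟩
    · rw [hc]
      linear_combination x * h₁ + ha
    · rw [hc]
      linear_combination x ^ 2 * h₂ + h₄ + 2 * x * h₇

theorem isGaussDominated_zero (a : R) : IsGaussDominated a 0 := ⟨0, by simp, by simp⟩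

theorem isGaussDominated_self (a : R) : IsGaussDominated a a := ⟨1, by simp, by simp⟩

theorem exists_isGaussDominated_coeff
    (h : ∀ a b : R, IsGaussDominated a b ∨ IsGaussDominated b a) (f : R[X]) :
    ∃ i, ∀ j, IsGaussDominated (f.coeff i) (f.coeff j) := by
  suffices ∀ s : Finset ℕ, ∃ i, ∀ j ∈ s, IsGaussDominated (f.coeff i) (f.coeff j) by
    obtain ⟨i, hi⟩ := this f.support
    refine ⟨i, fun j => ?_⟩
    by_cases hj : j ∈ f.support
    · exact hi j hj
    · rw [notMem_support_iff.1 hj]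
      exact isGaussDominated_zero _
  intro s
  induction s using Finset.induction_on with
  | empty => exact ⟨0, by simp⟩
  | insert k s _ ih =>
    obtain ⟨i, hi⟩ := ih
    rcases h (f.coeff i) (f.coeff k) with hik | hki
    · exact ⟨i, by simpa using ⟨hik, hi⟩⟩
    · refine ⟨k, ?_⟩
      simp only [Finset.mem_insert, forall_eq_or_imp]
      exact ⟨isGaussDominated_self _, fun j hj => hki.trans h (hi j hj)⟩

/-- A polynomial is, up to a square-zero part, a scalar multiple of a polynomial of unit content. -/
theorem exists_eq_C_mul_add (h : ∀ a b : R, IsGaussDominated a b ∨ IsGaussDominated b a)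
    (f : R[X]) : ∃ (a : R) (f' n : R[X]), f = C a * f' + n ∧ (∃ i, f'.coeff i = 1) ∧
      ∀ j, a * n.coeff j = 0 ∧ n.coeff j * n.coeff j = 0 := by
  obtain ⟨i, hi⟩ := exists_isGaussDominated_coeff h f
  choose y hy₁ hy₂ using hi
  let z : ℕ → R := fun j => if j = i then 1 else y j
  have hz : ∀ j, f.coeff i * (f.coeff j - z j * f.coeff i) = 0 ∧
      (f.coeff j - z j * f.coeff i) * (f.coeff j - z j * f.coeff i) = 0 := by
    intro j
    by_cases hj : j = i
    · simp [z, hj]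
    · simpa [z, hj] using ⟨hy₁ j, hy₂ j⟩
  let f' : R[X] := ∑ j ∈ insert i f.support, monomial j (z j)
  have hf' : ∀ j, f'.coeff j = if j ∈ insert i f.support then z j else 0 := fun j => by
    simp [f', finsetSum_coeff, coeff_monomial]
  refine ⟨f.coeff i, f', f - C (f.coeff i) * f', by ring, ⟨i, by simp [hf', z]⟩, fun j => ?_⟩
  rw [coeff_sub, coeff_C_mul, hf']
  split_ifs with hj
  · rw [mul_comm (f.coeff i) (z j)]
    exact hz j
  · rw [Finset.mem_insert, not_or, notMem_support_iff] at hj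
    simp [hj.2]

theorem contentIdeal_le_contentIdeal_mul {f : R[X]} {i : ℕ} (hf : f.coeff i = 1) (g : R[X]) :
    g.contentIdeal ≤ (f * g).contentIdeal := by
  set I := (f * g).contentIdeal with hI
  let φ := Ideal.Quotient.mk I
  have hfg : f.map φ * g.map φ = 0 := by
    rw [← Polynomial.map_mul, ← contentIdeal_eq_bot_iff, contentIdeal_map_eq_map_contentIdeal,
      ← hI, Ideal.map_quotient_self]
  have hreg : f.map φ ∈ (R ⧸ I)[X]⁰ := by
    by_contra hn
    obtain ⟨a, ha, haf⟩ := Polynomial.notMem_nonZeroDivisors_iff.1 hn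
    have := congrArg (fun p => p.coeff i) haf
    exact ha (by simpa [coeff_map, hf] using this)
  have hg := (mem_nonZeroDivisors_iff_left.1 hreg) _ hfg
  rw [← contentIdeal_eq_bot_iff, contentIdeal_map_eq_map_contentIdeal, Ideal.map_eq_bot_iff_le_ker,
    Ideal.mk_ker] at hg
  exact hg

theorem isGaussianRing_of_isGaussDominated_or
    (h : ∀ a b : R, IsGaussDominated a b ∨ IsGaussDominated b a) : IsGaussianRing R := by
  rw [isGaussianRing_iff]
  have key : ∀ (f g f' g' n m : R[X]) (a b : R), f = C a * f' + n → g = C b * g' + m →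
      (∃ i, f'.coeff i = 1) → (∀ j, a * n.coeff j = 0 ∧ n.coeff j * n.coeff j = 0) →
      (∀ j, m.coeff j * m.coeff j = 0) → IsGaussDominated a b →
      ∀ i j, f.coeff i * g.coeff j ∈ (f * g).contentIdeal := by
    rintro f g f' g' n m a b hf hg ⟨k, hk⟩ hn hm ⟨y, -, hz⟩ i j
    have hbn : ∀ i, n.coeff i * b = 0 := fun i => by
      have := mul_eq_zero_of_isGaussDominated_or (h _ _) hz (hn i).2
      linear_combination this + y * (hn i).1
    have hnm : ∀ i j, n.coeff i * m.coeff j = 0 := fun i j =>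
      mul_eq_zero_of_isGaussDominated_or (h _ _) (hn i).2 (hm j)
    have hng : ∀ i j, n.coeff i * g.coeff j = 0 := fun i j => by
      rw [hg, coeff_add, coeff_C_mul]
      linear_combination g'.coeff j * hbn i + hnm i j
    have hng' : n * g = 0 := by
      ext l
      rw [coeff_mul, coeff_zero]
      exact Finset.sum_eq_zero fun p _ => hng p.1 p.2
    have hfg : f * g = f' * (C a * g) := by
      rw [hf]
      linear_combination hng'
    have h₁ : a * g.coeff j ∈ (f * g).contentIdeal := by
      rw [hfg, ← coeff_C_mul]
      exact contentIdeal_le_contentIdeal_mul hk _ (coeff_mem_contentIdeal _ j)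
    convert Ideal.mul_mem_left _ (f'.coeff i) h₁ using 1
    rw [hf, coeff_add, coeff_C_mul]
    linear_combination hng i j
  intro f g i j
  obtain ⟨a, f', n, hf, hf', hn⟩ := exists_eq_C_mul_add h f
  obtain ⟨b, g', m, hg, hg', hm⟩ := exists_eq_C_mul_add h g
  rcases h a b with hab | hba
  · exact key f g f' g' n m a b hf hg hf' hn (fun j => (hm j).2) hab i j
  · rw [mul_comm (f.coeff i), mul_comm f]
    exact key g f g' f' m n b a hg hf hg' hm (fun j => (hn j).2) hba j i

theorem IsGaussianRing.of_isLocalization (h : IsGaussianRing R) (M : Submonoid R) (L : Type v)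
    [CommRing L] [Algebra R L] [IsLocalization M L] : IsGaussianRing L := by
  rw [isGaussianRing_iff] at h ⊢
  intro f g i j
  obtain ⟨s, hs, hf⟩ := IsLocalization.integerNormalization_spec M f
  obtain ⟨t, ht, hg⟩ := IsLocalization.integerNormalization_spec M g
  set f' := IsLocalization.integerNormalization M f
  set g' := IsLocalization.integerNormalization M g
  have hu : IsUnit (algebraMap R L (s * t)) := IsLocalization.map_units L (⟨_, mul_mem hs ht⟩ : M)
  have h₁ := Ideal.mem_map_of_mem (algebraMap R L) (h f' g' i j)
  rw [← contentIdeal_map_eq_map_contentIdeal, Polynomial.map_mul, map_mul, ← coeff_map,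
    ← coeff_map, hf, hg] at h₁
  have h₂ : (s • f) * (t • g) = (s * t) • (f * g) := by
    rw [smul_mul_smul_comm]
  rw [h₂] at h₁
  have h₃ : ((s * t) • (f * g)).contentIdeal ≤ (f * g).contentIdeal := by
    rw [algebra_compatible_smul L, smul_eq_C_mul]
    exact contentIdeal_le_contentIdeal_of_dvd (dvd_mul_left _ _)
  rw [← Ideal.unit_mul_mem_iff_mem _ hu]
  convert h₃ h₁ using 1
  rw [coeff_smul, coeff_smul, Algebra.smul_def, Algebra.smul_def, map_mul]
  ring

theorem isGaussianRing_of_localization_maximal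
    (h : ∀ (m : Ideal R) [m.IsMaximal], IsGaussianRing (Localization.AtPrime m)) :
    IsGaussianRing R := by
  rw [isGaussianRing_iff]
  intro f g i j
  refine Ideal.mem_of_localization_maximal fun m hm => ?_
  have := isGaussianRing_iff.1 (h m) (f.map (algebraMap _ _)) (g.map (algebraMap _ _)) i j
  rwa [← Polynomial.map_mul, contentIdeal_map_eq_map_contentIdeal, coeff_map, coeff_map,
    ← map_mul] at this

theorem HasComparability.isGaussianRing (h : HasComparability R) : IsGaussianRing R := by
  refine isGaussianRing_of_localization_maximal fun m hm =>
    isGaussianRing_of_isGaussDominated_or fun a b => ?_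
  refine ((h.of_isLocalization m.primeCompl _).dvd_total a b).imp ?_ ?_ <;>
  · rintro ⟨c, rfl⟩
    exact ⟨c, by ring, by ring⟩

end Gaussian

section Extension

open Polynomial

variable {A : Type u} {B : Type v} [CommRing A] [CommRing B] [Algebra A B]

theorem IsGaussianRing.of_exists_denominator (h : IsGaussianRing A) {s : B} (hs : s ∈ B⁰)
    (hsB : ∀ y : B, ∃ c : A, algebraMap A B c = s * y) : IsGaussianRing B := by
  rw [isGaussianRing_iff] at h ⊢
  have hlift : ∀ f : B[X], ∃ f' : A[X], f'.map (algebraMap A B) = C s * f := fun f => by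
    refine (mem_lifts _).1 ((lifts_iff_coeff_lifts _).2 fun n => ?_)
    rw [coeff_C_mul]
    exact hsB _
  intro f g i j
  obtain ⟨f', hf⟩ := hlift f
  obtain ⟨g', hg⟩ := hlift g
  have h₁ := Ideal.mem_map_of_mem (algebraMap A B) (h f' g' i j)
  rw [← contentIdeal_map_eq_map_contentIdeal, Polynomial.map_mul, map_mul, ← coeff_map,
    ← coeff_map, hf, hg, show C s * f * (C s * g) = C (s * s) * (f * g) by rw [C_mul]; ring] at h₁
  have h₂ := contentIdeal_mul_le_mul_contentIdeal _ _ h₁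
  rw [contentIdeal_C, Ideal.mem_span_singleton_mul] at h₂
  obtain ⟨z, hz, hz'⟩ := h₂
  convert hz
  refine (mul_cancel_left_mem_nonZeroDivisors (mul_mem hs hs)).1 ?_
  rw [hz', coeff_C_mul, coeff_C_mul]
  ring

theorem IsPruferExtension.localization (h : IsPruferExtension A B) (M : Submonoid A) :
    IsPruferExtension (Localization M) (Localization (Algebra.algebraMapSubmonoid B M)) := by
  intro x
  obtain ⟨⟨y, ⟨_, s, hs, rfl⟩⟩, hx⟩ := IsLocalization.surj (Algebra.algebraMapSubmonoid B M) x
  obtain ⟨t, d, r, h₁, h₂⟩ := h y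
  set V := Localization (Algebra.algebraMapSubmonoid B M)
  have hmap : ∀ a : A, algebraMap (Localization M) V (algebraMap A _ a) =
      algebraMap B V (algebraMap A B a) := fun a => by
    rw [← IsScalarTower.algebraMap_apply, ← IsScalarTower.algebraMap_apply]
  dsimp only at hx
  have hu : IsUnit (algebraMap B V (algebraMap A B s)) :=
    IsLocalization.map_units V (⟨_, s, hs, rfl⟩ : Algebra.algebraMapSubmonoid B M)
  refine ⟨algebraMap A _ t, algebraMap A _ (d * s), IsLocalization.mk' _ r ⟨s, hs⟩, ?_, ?_⟩
  · refine hu.mul_right_cancel ?_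
    rw [hmap, mul_assoc, hx, ← map_mul, h₁, ← hmap s, ← map_mul, ← hmap r]
    congr 1
    exact (IsLocalization.mk'_spec (Localization M) r (⟨s, hs⟩ : M)).symm
  · rw [← map_one (algebraMap A (Localization M)), ← map_sub, hmap, hmap, h₂, map_mul, map_mul,
      map_mul, ← hx]
    ring

theorem IsPruferExtension.isGaussianRing (h : IsPruferExtension A B)
    (hinj : Function.Injective (algebraMap A B)) (hB : IsGaussianRing B) : IsGaussianRing A := by
  refine isGaussianRing_of_localization_maximal fun m hm =>
    isGaussianRing_of_isGaussDominated_or ?_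
  let L := Localization m.primeCompl
  let V := Localization (Algebra.algebraMapSubmonoid B m.primeCompl)
  have hLV : Function.Injective (algebraMap L V) := localizationAlgebra_injective _ _ hinj
  have : Nontrivial V := hLV.nontrivial
  have hdich : ∀ y : V, (∃ x : L, algebraMap L V x = y) ∨ ∃ x : L, y * algebraMap L V x = 1 := by
    intro y
    obtain ⟨t, d, r, h₁, h₂⟩ := h.localization m.primeCompl y
    rcases IsLocalRing.isUnit_or_isUnit_one_sub_self t with ⟨t, rfl⟩ | ⟨t', ht'⟩
    · refine .inl ⟨↑t⁻¹ * r, ?_⟩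
      rw [map_mul, ← h₁, ← mul_assoc, ← map_mul, Units.inv_mul, map_one, one_mul]
    · refine .inr ⟨d * ↑t'⁻¹, ?_⟩
      rw [map_mul, ← mul_assoc, ← h₂, ← ht', ← map_mul, Units.mul_inv, map_one]
  have : IsLocalRing V := IsLocalRing.of_nonunits_add fun x y hx hy hxy => by
    obtain ⟨z, hz⟩ := hxy.exists_right_inv
    have hmem : ∀ w : V, ¬IsUnit w → ∃ x : L, algebraMap L V x = w ∧ ¬IsUnit x := fun w hw => by
      rcases hdich w with ⟨x, rfl⟩ | ⟨x, hx⟩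
      · exact ⟨x, rfl, fun h => hw (h.map _)⟩
      · exact absurd (IsUnit.of_mul_eq_one _ hx) hw
    obtain ⟨x', hx', hxu⟩ := hmem (x * z) fun h => hx (isUnit_of_mul_isUnit_left h)
    obtain ⟨y', hy', hyu⟩ := hmem (y * z) fun h => hy (isUnit_of_mul_isUnit_left h)
    have : x' + y' = 1 := hLV (by rw [map_add, hx', hy', map_one, ← hz, add_mul])
    exact IsLocalRing.nonunits_add hxu hyu (this ▸ isUnit_one)
  have hV : IsGaussianRing V := hB.of_isLocalization (Algebra.algebraMapSubmonoid B m.primeCompl) V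
  have key : ∀ a b : L, IsGaussDominated (algebraMap L V a) (algebraMap L V b) →
      IsGaussDominated a b ∨ IsGaussDominated b a := by
    rintro a b ⟨y, h₁, h₂⟩
    rcases hdich y with ⟨y, rfl⟩ | ⟨z, hz⟩
    · exact .inl ⟨y, hLV (by simpa using h₁), hLV (by simpa using h₂)⟩
    · refine .inr ⟨z, hLV ?_, hLV ?_⟩ <;> simp only [map_mul, map_sub, map_zero] <;>
        set a' := algebraMap L V a <;> set b' := algebraMap L V b <;> set z' := algebraMap L V z
      · linear_combination (-1 : V) * z' * h₂ - y * z' * h₁ - a' * b' * hz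
      · linear_combination z' ^ 2 * h₂ + 2 * z' * (y * z' - 1) * h₁ + a' ^ 2 * (y * z' - 1) * hz
  intro a b
  rcases hV.isGaussDominated_or (algebraMap L V a) (algebraMap L V b) with hab | hba
  · exact key a b hab
  · exact (key b a hba).symm

end Extension

theorem IsFractionExtension.isReduced {A : Type u} {B : Type v} [CommRing A] [CommRing B]
    [Algebra A B] (hB : IsFractionExtension A B) (hinj : Function.Injective (algebraMap A B))
    [IsReduced A] : IsReduced B := by
  refine isReduced_iff_pow_one_lt 2 one_lt_two |>.2 fun y hy => ?_
  obtain ⟨s, c, hs, hc⟩ := hB y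
  have h₁ : c * c = 0 := hinj (by
    rw [map_mul, ← hc, map_zero]
    linear_combination algebraMap A B s ^ 2 * hy)
  have h₂ : c = 0 := IsReduced.eq_zero c ⟨2, by rw [sq, h₁]⟩
  rw [h₂, map_zero] at hc
  exact (mul_left_mem_nonZeroDivisors_eq_zero_iff hs).1 hc

section Pullback

variable {B : Type u} {T : Type v} [CommRing B] [CommRing T] {π : B →+* T} {R : Subring T}

theorem hasRegularComparability_comap_iff (hπ : Function.Surjective π)
    (hR : IsAbsolutelyFlat (FractionRing R)) (hker : IsRegularIdeal (RingHom.ker π)) :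
    HasRegularComparability (R.comap π) ↔
      HasRegularComparability B ∧ HasRegularComparability R ∧ IsOverring R T := by
  have hfrac := isFractionExtension_comap (R := R) hker
  constructor
  · intro h
    have h' := h.of_comap hπ hker
    exact ⟨hfrac.hasRegularComparability algebraMap_comap_injective h, h',
      ((isPruferExtension_comap_iff hπ).1
        (h.isPruferExtension algebraMap_comap_injective hfrac)).isOverring
          Subtype.val_injective (h'.hasIdempotentSupports hR)⟩
  · rintro ⟨hB, hR', hT⟩
    exact ((isPruferExtension_comap_iff hπ).2
      (hR'.isPruferExtension hT.injective hT.isFractionExtension)).hasRegularComparability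
        algebraMap_comap_injective (mem_nonZeroDivisors_of_comap hker) hB

end Pullback

section PruferCondition

variable {R : Type u} [CommRing R] {n : ℕ}

theorem HasPruferCondition.hasRegularComparability (h : HasPruferCondition n R) :
    HasRegularComparability R := by
  match n, h with
  | 1, h => exact (isSemihereditaryRing_iff.1 h).1
  | 2, h => exact (hasWeakGlobalDimLEOne_iff.1 h).1.hasRegularComparability
  | 3, h => exact (isArithmeticalRing_iff.1 h).hasRegularComparability
  | 4, h => exact IsGaussianRing.hasRegularComparability h
  | 5, h => exact isPruferRing_iff.1 h

theorem IsSemihereditaryRing.hasPruferCondition (h : IsSemihereditaryRing R)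
    (hn : n ∈ Finset.Icc 1 5) : HasPruferCondition n R := by
  have hc := h.hasComparability
  have : IsReduced R := isReduced_iff_pow_one_lt 2 one_lt_two |>.2 fun a ha => by
    have := h (Ideal.span {a}) (Submodule.fg_span_singleton a)
    exact eq_zero_of_sq_eq_zero_of_flat a (by rw [← sq, ha])
  fin_cases hn
  · exact h
  · exact hc.hasWeakGlobalDimLEOne
  · exact isArithmeticalRing_iff.2 hc
  · exact hc.isGaussianRing
  · exact isPruferRing_iff.2 hc.hasRegularComparability

end PruferCondition

section Pullback

variable {B : Type u} {T : Type v} [CommRing B] [CommRing T] {π : B →+* T} {R : Subring T}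

theorem HasPruferCondition.of_comap {n : ℕ} (hker : IsRegularIdeal (RingHom.ker π))
    (h : HasPruferCondition n (R.comap π)) : HasPruferCondition n B := by
  have hfrac := isFractionExtension_comap (R := R) hker
  have hinj := algebraMap_comap_injective (π := π) (R := R)
  have hP := hfrac.hasRegularComparability hinj h.hasRegularComparability
  match n, h with
  | 1, h => exact isSemihereditaryRing_iff.2 ⟨hP, hfrac.hasIdempotentSupports
      (mem_nonZeroDivisors_of_comap hker) (isSemihereditaryRing_iff.1 h).2⟩
  | 2, h =>
    obtain ⟨h₁, h₂⟩ := hasWeakGlobalDimLEOne_iff.1 h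
    exact hasWeakGlobalDimLEOne_iff.2 ⟨hfrac.hasComparability hinj h₁, hfrac.isReduced hinj⟩
  | 3, h => exact
    isArithmeticalRing_iff.2 (hfrac.hasComparability hinj (isArithmeticalRing_iff.1 h))
  | 4, h =>
    obtain ⟨s, hs, hs'⟩ := hker
    exact IsGaussianRing.of_exists_denominator h hs' fun y =>
      ⟨⟨s * y, mem_comap_of_mem_ker (Ideal.mul_mem_right _ _ hs)⟩, rfl⟩
  | 5, h => exact isPruferRing_iff.2 hP

theorem HasPruferCondition.comap {n : ℕ} (h : HasPruferCondition n B)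
    (hP : HasRegularComparability (R.comap π)) (hPE : IsPruferExtension (R.comap π) B) :
    HasPruferCondition n (R.comap π) := by
  have hinj := algebraMap_comap_injective (π := π) (R := R)
  match n, h with
  | 1, h => exact isSemihereditaryRing_iff.2 ⟨hP,
      hPE.hasIdempotentSupports hinj (isSemihereditaryRing_iff.1 h).2⟩
  | 2, h =>
    obtain ⟨h₁, h₂⟩ := hasWeakGlobalDimLEOne_iff.1 h
    exact hasWeakGlobalDimLEOne_iff.2 ⟨hPE.hasComparability hinj h₁,
      isReduced_of_injective (algebraMap (R.comap π) B) hinj⟩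
  | 3, h => exact
    isArithmeticalRing_iff.2 (hPE.hasComparability hinj (isArithmeticalRing_iff.1 h))
  | 4, h => exact hPE.isGaussianRing hinj h
  | 5, h => exact isPruferRing_iff.2 hP

end Pullback

theorem mainTheorem11 {B : Type u} {T : Type v} [CommRing B] [CommRing T]
    (π : B →+* T) (hπ : Function.Surjective π) (R : Subring T)
    (hR : IsAbsolutelyFlat (FractionRing R)) (hker : IsRegularIdeal (RingHom.ker π))
    (n : ℕ) (hn : n ∈ Finset.Icc 1 5) :
    HasPruferCondition n (R.comap π) ↔
      (HasPruferCondition n B ∧ HasPruferCondition n R ∧ IsOverring R T) := by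
  have hiff := hasRegularComparability_comap_iff hπ hR hker
  constructor
  · intro h
    obtain ⟨-, hR', hT⟩ := hiff.1 h.hasRegularComparability
    exact ⟨h.of_comap hker, (isSemihereditaryRing_iff.2
      ⟨hR', hR'.hasIdempotentSupports hR⟩).hasPruferCondition hn, hT⟩
  · rintro ⟨hB, hR', hT⟩
    have hA := hiff.2 ⟨hB.hasRegularComparability, hR'.hasRegularComparability, hT⟩
    exact hB.comap hA (hA.isPruferExtension algebraMap_comap_injective
      (isFractionExtension_comap hker))
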